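/- **Categories of operations.** Let $\mathcal C$ be a symmetric monoidal category with unit $I$ such that (i) every morphism set $\mathcal C(X,Y)$ is a module over the semiring $\mathbb R_+$ of nonnegative reals; (ii) composition and tensor product of morphisms are bilinear; (iii) there is a distinguished symmetric monoidal subcategory $\mathcal P\subseteq\mathcal C$ containing all identity morphisms (its morphisms are called *normalized*); (iv) $\mathcal C(I,I)=\mathbb R_+$, i.e. $r\mapsto r\cdot\mathrm{id}_I$ is a bijection $\mathbb R_+\to\mathcal C(I,I)$, and $\mathcal P(I,I)=\{\mathrm{id}_I\}$; (v) $I$ is terminal in $\mathcal P$, i.e. every $\mathcal P(X,I)$ has exactly one element. **Graphs and polarizations.** Let $G=(V,E)$, $E\subseteq V\times V$, be a finite directed acyclic graph; for $v\in V$ let $\mathrm{in}(v)$ and $\mathrm{out}(v)$ be the sets of edges with target, respectively source, $v$. A *polarization* $\pi$ of $G$ is a choice of a linear ordering on each of the sets $\mathrm{in}(v)$ and $\mathrm{out}(v)$, $v\in V$. Given $\pi$ and objects $X_e\in\mathcal C$ for $e\in E$, the iterated tensor products $\bigotimes_{e\in\mathrm{in}(v)}X_e$ and $\bigotimes_{e\in\mathrm{out}(v)}X_e$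 are formed in the chosen orderings. If moreover every node $v$ is labelled by a morphism $g_v:\bigotimes_{e\in\mathrm{in}(v)}X_e\to\bigotimes_{e\in\mathrm{out}(v)}X_e$, then the polarized graph so labelled is a diagram in $\mathcal C$, and its *value* is the composite $I\to I$ obtained by cutting the diagram into slices: one runs through the nodes, each exactly once, in an order in which every edge goes forward, keeping a list of the currently open edges (empty at the start and at the end); for each node $v$ one permutes the tensor factors with the symmetry of $\mathcal C$ so that the edges of $\mathrm{in}(v)$ come first and in the prescribed order, and then applies $g_v\otimes\mathrm{id}$, which replaces them by the edges of $\mathrm{out}(v)$ in the prescribed order. (The value is the common composite of all such slicings; by Joyal and Street it does not depend on the slicing.) **$\mathcal C$-correlations.** Let $O_v$, $v\in V$, be finite sets of outcomes. A family of numbers $P(o)\in\mathbb R_+$, indexed by the tuples $o=(o_v)_{v\in V}\in\prod_{v}O_v$, is a *$\mathcal C$-correlation on $G$ with respect to $\pi$* if there are objects $X_e\in\mathcal C$ ($e\in E$) and maps $$f_v: O_v\longrightarrow \mathcal C\Big(\bigotimes_{e\in\mathrm{in}(v)}X_e,\ \bigotimes_{e\in\mathrm{out}(v)}X_e\Big)\qquad(v\in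 V)$$ which are instruments, i.e. $\sum_{o_v\in O_v}f_v(o_v)$ is normalized, such that for every tuple $o$ the value of the diagram with edge labels $X_e$ and node labels $f_v(o_v)$ is $P(o)\cdot\mathrm{id}_I$. **Proposition.** For every such $\mathcal C$, $G$ and $(O_v)_{v\in V}$, the set of $\mathcal C$-correlations on $G$ does not depend on the orderings chosen on the sets $\mathrm{in}(v)$ and $\mathrm{out}(v)$: for any two polarizations $\pi,\pi'$ of $G$, a family $(P(o))_o$ is a $\mathcal C$-correlation with respect to $\pi$ if and only if it is one with respect to $\pi'$. -/

import Mathlib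

open CategoryTheory MonoidalCategory
open scoped NNReal

universe w u v t

/-- A symmetric monoidal category of operations: the morphism sets are modules over the semiring of
nonnegative reals, composition and tensor product are bilinear, and there is a distinguished
symmetric monoidal subcategory `normalized`, containing all objects and all identities, such that
the scalars `I ⟶ I` are exactly the nonnegative multiples of the identity, the only normalized
scalar is the identity, and `I` is terminal in the subcategory of normalized operations. -/
class OperationCategory (C : Type u) [Category.{w} C] [MonoidalCategory C]
    [SymmetricCategory C] where
  homAddCommMonoid : ∀ X Y : C, AddCommMonoid (X ⟶ Y)
  homModule : ∀ X Y : C, Module ℝ≥0 (X ⟶ Y)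
  add_comp : ∀ {X Y Z : C} (f f' : X ⟶ Y) (g : Y ⟶ Z), (f + f') ≫ g = f ≫ g + f' ≫ g
  comp_add : ∀ {X Y Z : C} (f : X ⟶ Y) (g g' : Y ⟶ Z), f ≫ (g + g') = f ≫ g + f ≫ g'
  smul_comp : ∀ {X Y Z : C} (r : ℝ≥0) (f : X ⟶ Y) (g : Y ⟶ Z), (r • f) ≫ g = r • (f ≫ g)
  comp_smul : ∀ {X Y Z : C} (r : ℝ≥0) (f : X ⟶ Y) (g : Y ⟶ Z), f ≫ (r • g) = r • (f ≫ g)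
  add_tensor : ∀ {X Y X' Y' : C} (f f' : X ⟶ Y) (g : X' ⟶ Y'),
    (f + f') ⊗ₘ g = (f ⊗ₘ g) + (f' ⊗ₘ g)
  tensor_add : ∀ {X Y X' Y' : C} (f : X ⟶ Y) (g g' : X' ⟶ Y'),
    f ⊗ₘ (g + g') = (f ⊗ₘ g) + (f ⊗ₘ g')
  smul_tensor : ∀ {X Y X' Y' : C} (r : ℝ≥0) (f : X ⟶ Y) (g : X' ⟶ Y'),
    (r • f) ⊗ₘ g = r • (f ⊗ₘ g)
  tensor_smul : ∀ {X Y X' Y' : C} (r : ℝ≥0) (f : X ⟶ Y) (g : X' ⟶ Y'),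
    f ⊗ₘ (r • g) = r • (f ⊗ₘ g)
  normalized : MorphismProperty C
  normalized_symmetricMonoidal : normalized.IsStableUnderBraiding
  scalar_bijective : Function.Bijective fun r : ℝ≥0 => r • 𝟙 (𝟙_ C)
  normalized_scalar_iff : ∀ f : 𝟙_ C ⟶ 𝟙_ C, normalized f ↔ f = 𝟙 (𝟙_ C)
  existsUnique_discard : ∀ X : C, ∃! f : X ⟶ 𝟙_ C, normalized f

attribute [reducible, instance] OperationCategory.homAddCommMonoid OperationCategory.homModule

namespace Digraph

variable {V : Type v} (G : Digraph V)

/-- There is no directed path of positive length from a node to itself. -/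
def IsAcyclic : Prop := ∀ x : V, ¬ Relation.TransGen G.Adj x x

/-- The edge set `E ⊆ V × V`. -/
abbrev Edge : Type v := {e : V × V // G.Adj e.1 e.2}

/-- The set `in(x)` of edges with target `x`. -/
abbrev In (x : V) : Type v := {e : G.Edge // e.1.2 = x}

/-- The set `out(x)` of edges with source `x`. -/
abbrev Out (x : V) : Type v := {e : G.Edge // e.1.1 = x}

/-- A polarization: a linear ordering on each of the sets `in(x)` and `out(x)`. -/
structure Polarization where
  inOrder : ∀ x : V, LinearOrder (G.In x)
  outOrder : ∀ x : V, LinearOrder (G.Out x)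

namespace Polarization

variable {G} [Fintype V] (p : G.Polarization) (x : V)

open Classical in
/-- The edges in `in(x)`, listed increasingly. -/
noncomputable def inList : List G.Edge :=
  letI := p.inOrder x
  ((Finset.univ : Finset (G.In x)).sort (· ≤ ·)).map Subtype.val

open Classical in
/-- The edges in `out(x)`, listed increasingly. -/
noncomputable def outList : List G.Edge :=
  letI := p.outOrder x
  ((Finset.univ : Finset (G.Out x)).sort (· ≤ ·)).map Subtype.val

end Polarization

end Digraph

section Tensor

variable {C : Type u} [Category.{w} C] [MonoidalCategory C] {E : Type v} (X : E → C)

/-- The iterated tensor product `X e₁ ⊗ (X e₂ ⊗ (⋯ ⊗ I))` along a list of labels. -/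
def tensorList : List E → C
  | [] => 𝟙_ C
  | e :: l => X e ⊗ tensorList l

/-- The canonical isomorphism built from associators and unitors (an identity in the strict
case). -/
def tensorListAppend : ∀ l m : List E, tensorList X (l ++ m) ≅ tensorList X l ⊗ tensorList X m
  | [], m => (λ_ (tensorList X m)).symm
  | e :: l, m =>
      whiskerLeftIso (X e) (tensorListAppend l m) ≪≫
        (α_ (X e) (tensorList X l) (tensorList X m)).symm

/-- A rearrangement of a list into another one, presented as a composite of exchanges of
neighbours. It is the data-carrying version of `List.Perm`, with the same constructors. -/
inductive Shuffle {E : Type v} : List E → List E → Type v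
  | nil : Shuffle [] []
  | cons (e : E) {l m : List E} : Shuffle l m → Shuffle (e :: l) (e :: m)
  | swap (e e' : E) (l : List E) : Shuffle (e :: e' :: l) (e' :: e :: l)
  | trans {l m n : List E} : Shuffle l m → Shuffle m n → Shuffle l n

/-- The morphism permuting the tensor factors, built from the symmetry. -/
def Shuffle.hom [BraidedCategory C] :
    ∀ {l m : List E}, Shuffle l m → (tensorList X l ⟶ tensorList X m)
  | _, _, .nil => 𝟙 (𝟙_ C)
  | _, _, .cons e s => X e ◁ s.hom
  | _, _, .swap e e' l =>
      (α_ (X e) (X e') (tensorList X l)).inv ≫ (β_ (X e) (X e')).hom ▷ tensorList X l ≫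
        (α_ (X e') (X e) (tensorList X l)).hom
  | _, _, .trans s s' => s.hom ≫ s'.hom

end Tensor

namespace Digraph

namespace Polarization

variable {V : Type v} [Fintype V] {G : Digraph V}

/-- `p.Slicing xs l`: a way to cut the part of the polarized diagram that contains the nodes `xs`
(drawn in this order from input to output), has the open incoming edges `l` and no open outgoing
edges, into slices. Each slice first rearranges the open edges so that the edges entering the next
node `x` come first and in the order prescribed on `in(x)`, and then replaces them by the edges
leaving `x`, in the order prescribed on `out(x)`. -/
inductive Slicing (p : G.Polarization) : List V → List G.Edge → Type v
  | nil : Slicing p [] []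
  | cons (x : V) {xs : List V} {l : List G.Edge} (rest : List G.Edge)
      (s : Shuffle l (p.inList x ++ rest)) (k : Slicing p xs (p.outList x ++ rest)) :
      Slicing p (x :: xs) l

variable {C : Type u} [Category.{w} C] [MonoidalCategory C] [BraidedCategory C]

/-- The type of the operation labelling the node `x`, when the edges are labelled by `X`. -/
abbrev NodeHom (p : G.Polarization) (X : G.Edge → C) (x : V) : Type w :=
  tensorList X (p.inList x) ⟶ tensorList X (p.outList x)

/-- The composite of the slices, each interpreted in `C` with edges labelled by the objects `X` and
nodes labelled by the morphisms `g`. -/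
noncomputable def Slicing.composite {p : G.Polarization} (X : G.Edge → C) (g : ∀ x, p.NodeHom X x) :
    ∀ {xs : List V} {l : List G.Edge}, p.Slicing xs l → (tensorList X l ⟶ 𝟙_ C)
  | _, _, .nil => 𝟙 (𝟙_ C)
  | _, _, .cons x rest s k =>
      s.hom X ≫ (tensorListAppend X (p.inList x) rest).hom ≫ g x ▷ tensorList X rest ≫
        (tensorListAppend X (p.outList x) rest).inv ≫ k.composite X g

/-- All composites `I ⟶ I` of the slicings of the whole diagram, in which every node occurs exactly
once. -/
def composites (p : G.Polarization) (X : G.Edge → C) (g : ∀ x, p.NodeHom X x) :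
    Set (𝟙_ C ⟶ 𝟙_ C) :=
  {c | ∃ xs : List V, xs.Nodup ∧ (∀ x, x ∈ xs) ∧ ∃ s : p.Slicing xs [], s.composite X g = c}

/-- `c` is the value of the polarized diagram: the diagram can be sliced, and every slicing of it
composes to `c`. -/
def IsValue (p : G.Polarization) (X : G.Edge → C) (g : ∀ x, p.NodeHom X x)
    (c : 𝟙_ C ⟶ 𝟙_ C) : Prop :=
  p.composites X g = {c}

end Polarization

end Digraph

section Correlation

variable {V : Type v} [Fintype V] {G : Digraph V} {C : Type u} [Category.{w} C]
  [MonoidalCategory C] [SymmetricCategory C] [OperationCategory C]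

/-- An instrument with finite outcome set: a family of operations whose sum is normalized. -/
def IsInstrument {O : Type t} [Fintype O] {A B : C} (f : O → (A ⟶ B)) : Prop :=
  OperationCategory.normalized (∑ o, f o)

variable (C) in
/-- The set of `C`-correlations on `G`, with outcome sets `O`, relative to a polarization of `G`: the
families of numbers `P o` which arise as the values of the diagrams obtained from some labelling of
the edges by objects and of the nodes by instruments. -/
def correlations (p : G.Polarization) (O : V → Type t) [∀ x, Fintype (O x)] :
    Set ((∀ x, O x) → ℝ≥0) :=
  {P | ∃ (X : G.Edge → C) (f : ∀ x, O x → p.NodeHom X x), (∀ x, IsInstrument (f x)) ∧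
    ∀ o : ∀ x, O x, p.IsValue X (fun x => f x (o x)) (P o • 𝟙 (𝟙_ C))}

end Correlation

/-! Keep the objects `X` and conjugate each instrument by permutations of its input and output
factors that turn one ordering into the other. These permutations are built from structure
morphisms, hence normalized, so by bilinearity the result is again an instrument
(`IsInstrument.comp_comp`). A permutation next to a node can be absorbed into the rearrangements of
open edges already present in the slices, so each slicing for one polarization yields one for the
other with the same composite (`Slicing.exists_composite_eq`). Since permutations are invertible,
the two sets of composites coincide (`composites_subset` both ways), so existence and uniqueness of
the value are carried over together, without a coherence theorem. -/

section ShuffleLemmas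

variable {E : Type v}

/-! ### Permutations of tensor factors -/

namespace Shuffle

/-- The identity rearrangement. -/
def refl : ∀ l : List E, Shuffle l l
  | [] => .nil
  | e :: l => .cons e (refl l)

/-- The inverse rearrangement. -/
def symm : ∀ {l m : List E}, Shuffle l m → Shuffle m l
  | _, _, .nil => .nil
  | _, _, .cons e s => .cons e s.symm
  | _, _, .swap e e' l => .swap e' e l
  | _, _, .trans s s' => .trans s'.symm s.symm

/-- A rearrangement of an initial segment of a list. -/
def appendRight (r : List E) : ∀ {l m : List E}, Shuffle l m → Shuffle (l ++ r) (m ++ r)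
  | _, _, .nil => refl r
  | _, _, .cons e s => .cons e (s.appendRight r)
  | _, _, .swap e e' l => .swap e e' (l ++ r)
  | _, _, .trans s s' => .trans (s.appendRight r) (s'.appendRight r)

theorem length_eq {l m : List E} (s : Shuffle l m) : l.length = m.length := by
  induction s with
  | nil => rfl
  | cons e s ih => simp [ih]
  | swap e e' l => rfl
  | trans s s' ih ih' => exact ih.trans ih'

theorem nonempty_of_perm {l m : List E} (h : l.Perm m) : Nonempty (Shuffle l m) := by
  induction h with
  | nil => exact ⟨.nil⟩
  | cons e _ ih => exact ih.map (.cons e)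
  | swap e e' l => exact ⟨.swap e' e l⟩
  | trans _ _ ih ih' => exact ih.elim fun s => ih'.map s.trans

variable {C : Type u} [Category.{w} C] [MonoidalCategory C]

/-- The swap case of `appendRight_hom`. Only the interchange law and monoidal coherence matter, so
`β` need not be the braiding. -/
theorem whiskerLeft_whiskerLeft_exchange {A B W L R : C} (β : A ⊗ B ⟶ B ⊗ A) (T : W ⟶ L ⊗ R) :
    ((α_ A B W).inv ≫ β ▷ W ≫ (α_ B A W).hom) ≫
        B ◁ (A ◁ T ≫ (α_ A L R).inv) ≫ (α_ B (A ⊗ L) R).inv =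
      (A ◁ (B ◁ T ≫ (α_ B L R).inv) ≫ (α_ A (B ⊗ L) R).inv) ≫
        ((α_ A B L).inv ≫ β ▷ L ≫ (α_ B A L).hom) ▷ R := by
  have h : β ▷ W ≫ (B ⊗ A) ◁ T = (A ⊗ B) ◁ T ≫ β ▷ (L ⊗ R) :=
    (MonoidalCategory.whisker_exchange β T).symm
  calc
    _ = (α_ A B W).inv ≫ (β ▷ W ≫ (B ⊗ A) ◁ T) ≫ (α_ B A (L ⊗ R)).hom ≫
          B ◁ (α_ A L R).inv ≫ (α_ B (A ⊗ L) R).inv := by monoidal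
    _ = _ := by rw [h]; monoidal

section Braided

variable [BraidedCategory C] (X : E → C)

@[simp]
theorem refl_hom (l : List E) : (refl l).hom X = 𝟙 (tensorList X l) := by
  induction l with
  | nil => rfl
  | cons e l ih => simp [refl, hom, ih, tensorList]

theorem appendRight_hom {l m : List E} (s : Shuffle l m) (r : List E) :
    (s.appendRight r).hom X ≫ (tensorListAppend X m r).hom =
      (tensorListAppend X l r).hom ≫ s.hom X ▷ tensorList X r := by
  induction s with
  | nil => simp [appendRight, hom, tensorList]
  | cons e s ih =>
    have h := congrArg (X e ◁ ·) ih
    simp only [MonoidalCategory.whiskerLeft_comp] at h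
    simp [appendRight, hom, tensorListAppend, tensorList, reassoc_of% h]
  | swap e e' l =>
    exact whiskerLeft_whiskerLeft_exchange (β_ (X e) (X e')).hom (tensorListAppend X l r).hom
  | trans s s' ih ih' =>
    simp [appendRight, hom, ih', reassoc_of% ih]

/-- Every rearrangement of the empty list is interpreted as the identity. -/
theorem hom_eq_id_of_nil (s : Shuffle ([] : List E) []) : s.hom X = 𝟙 (𝟙_ C) := by
  -- Induction needs free indices; in a `trans`, the intermediate list is empty because shuffles
  -- preserve length.
  suffices ∀ {l m : List E} (s : Shuffle l m) (hl : l = []) (hm : m = []),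
      s.hom X = eqToHom (by rw [hl, hm]) from
    this s rfl rfl
  intro l m s
  induction s with
  | nil => intros; rfl
  | cons => intro hl; cases hl
  | swap => intro hl; cases hl
  | trans s s' ih ih' =>
    intro hl hm
    have := s'.length_eq
    subst hm
    have hm := List.eq_nil_of_length_eq_zero this
    simp [hom, ih hl hm, ih' hm rfl]

end Braided

section Symmetric

variable [SymmetricCategory C] (X : E → C)

/-- The `swap` case is where symmetry, rather than a mere braiding, enters: exchanging twice is the
identity. -/
theorem hom_comp_symm_hom {l m : List E} (s : Shuffle l m) :
    s.hom X ≫ s.symm.hom X = 𝟙 (tensorList X l) := by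
  induction s with
  | nil => simp [symm, hom, tensorList]
  | cons e s ih => simp [symm, hom, tensorList, ← MonoidalCategory.whiskerLeft_comp, ih]
  | swap e e' l => simp [symm, hom, tensorList, ← MonoidalCategory.comp_whiskerRight_assoc]
  | trans s s' ih ih' => simp [symm, hom, reassoc_of% ih', ih]

theorem symm_hom_comp_hom {l m : List E} (s : Shuffle l m) :
    s.symm.hom X ≫ s.hom X = 𝟙 (tensorList X m) := by
  induction s with
  | nil => simp [symm, hom, tensorList]
  | cons e s ih => simp [symm, hom, tensorList, ← MonoidalCategory.whiskerLeft_comp, ih]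
  | swap e e' l => simp [symm, hom, tensorList, ← MonoidalCategory.comp_whiskerRight_assoc]
  | trans s s' ih ih' => simp [symm, hom, reassoc_of% ih, ih']

theorem normalized_hom [OperationCategory C] {l m : List E} (s : Shuffle l m) :
    OperationCategory.normalized (s.hom X) := by
  have := OperationCategory.normalized_symmetricMonoidal (C := C)
  induction s with
  | nil => exact MorphismProperty.id_mem _ _
  | cons e s ih => exact MorphismProperty.whiskerLeft_mem _ _ _ ih
  | swap e e' l =>
    exact MorphismProperty.comp_mem _ _ _ (MorphismProperty.associator_inv_mem _ _ _ _)
      (MorphismProperty.comp_mem _ _ _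
        (MorphismProperty.whiskerRight_mem _ _ (MorphismProperty.braiding_hom_mem _ _ _) _)
        (MorphismProperty.associator_hom_mem _ _ _ _))
  | trans s s' ih ih' => exact MorphismProperty.comp_mem _ _ _ ih ih'

end Symmetric

end Shuffle

end ShuffleLemmas

/-! ### Changing the polarization of a sliced diagram -/

namespace Digraph

namespace Polarization

variable {V : Type v} [Fintype V] {G : Digraph V}

theorem inList_perm (p q : G.Polarization) (x : V) : (p.inList x).Perm (q.inList x) := by
  unfold inList
  -- Both lists sort the same finite set, so they agree as multisets.
  refine List.Perm.map _ (Multiset.coe_eq_coe.mp ?_)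
  rw [Finset.sort_eq, Finset.sort_eq]

theorem outList_perm (p q : G.Polarization) (x : V) : (p.outList x).Perm (q.outList x) := by
  unfold outList
  refine List.Perm.map _ (Multiset.coe_eq_coe.mp ?_)
  rw [Finset.sort_eq, Finset.sort_eq]

variable {C : Type u} [Category.{w} C] [MonoidalCategory C] [BraidedCategory C]

/-- A rearrangement of the open edges can be absorbed into the first slice. -/
theorem Slicing.exists_composite_eq_shuffle_comp {p : G.Polarization} (X : G.Edge → C)
    (g : ∀ x, p.NodeHom X x) {xs : List V} {l m : List G.Edge} (s : Shuffle l m)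
    (k : p.Slicing xs m) :
    ∃ k' : p.Slicing xs l, k'.composite X g = s.hom X ≫ k.composite X g := by
  cases k with
  | nil =>
    -- No slice remains to absorb `s`, but it can only permute the empty list.
    obtain rfl := List.eq_nil_of_length_eq_zero s.length_eq
    exact ⟨.nil, by rw [s.hom_eq_id_of_nil]; exact (Category.id_comp _).symm⟩
  | cons x rest t k => exact ⟨.cons x rest (s.trans t) k, by simp [composite, Shuffle.hom]⟩

/-- If the operations `g'` arise from `g` by rearranging inputs and outputs, then every slicing for
`g'` composes to the same morphism as some slicing for `g`. -/
theorem Slicing.exists_composite_eq {p q : G.Polarization} (X : G.Edge → C)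
    (g : ∀ x, p.NodeHom X x) (g' : ∀ x, q.NodeHom X x)
    (a : ∀ x, Shuffle (q.inList x) (p.inList x)) (b : ∀ x, Shuffle (p.outList x) (q.outList x))
    (h : ∀ x, g' x = (a x).hom X ≫ g x ≫ (b x).hom X) {xs : List V} {l : List G.Edge}
    (k : q.Slicing xs l) : ∃ k' : p.Slicing xs l, k'.composite X g = k.composite X g' := by
  induction k with
  | nil => exact ⟨.nil, rfl⟩
  | cons x rest s k ih =>
    obtain ⟨k₁, h₁⟩ := ih
    -- The output permutation passes to the following slice; the input permutation `a x` joins the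
    -- rearrangement `s` of the current one.
    obtain ⟨k₂, h₂⟩ := exists_composite_eq_shuffle_comp X g ((b x).appendRight rest) k₁
    refine ⟨.cons x rest (s.trans ((a x).appendRight rest)) k₂, ?_⟩
    have hb : (tensorListAppend X (p.outList x) rest).inv ≫ ((b x).appendRight rest).hom X =
        (b x).hom X ▷ tensorList X rest ≫ (tensorListAppend X (q.outList x) rest).inv := by
      rw [Iso.inv_comp_eq, ← Category.assoc, Iso.eq_comp_inv, Shuffle.appendRight_hom]
    simp only [composite, Shuffle.hom, h₂, ← h₁, h, MonoidalCategory.comp_whiskerRight,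
      Category.assoc, reassoc_of% hb, reassoc_of% (Shuffle.appendRight_hom X (a x) rest)]

theorem composites_subset {p q : G.Polarization} (X : G.Edge → C)
    (g : ∀ x, p.NodeHom X x) (g' : ∀ x, q.NodeHom X x)
    (a : ∀ x, Shuffle (q.inList x) (p.inList x)) (b : ∀ x, Shuffle (p.outList x) (q.outList x))
    (h : ∀ x, g' x = (a x).hom X ≫ g x ≫ (b x).hom X) :
    q.composites X g' ⊆ p.composites X g := by
  rintro _ ⟨xs, hn, hx, k, rfl⟩
  exact ⟨xs, hn, hx, Slicing.exists_composite_eq X g g' a b h k⟩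

end Polarization

end Digraph

/-! ### Conjugated instruments and correlations -/

section CorrelationLemmas

variable {C : Type u} [Category.{w} C] [MonoidalCategory C] [SymmetricCategory C]
  [OperationCategory C]

theorem OperationCategory.comp_sum_comp {O : Type t} [Fintype O] {A B A' B' : C}
    (a : A' ⟶ A) (f : O → (A ⟶ B)) (b : B ⟶ B') :
    ∑ o, a ≫ f o ≫ b = a ≫ (∑ o, f o) ≫ b := by
  let φ : (A ⟶ B) →ₗ[ℝ≥0] (A' ⟶ B') :=
    { toFun := fun g => a ≫ g ≫ b
      map_add' := fun g g' => by rw [add_comp, comp_add]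
      map_smul' := fun r g => by rw [smul_comp, comp_smul, RingHom.id_apply] }
  exact (map_sum φ f Finset.univ).symm

theorem IsInstrument.comp_comp {O : Type t} [Fintype O] {A B A' B' : C} {f : O → (A ⟶ B)}
    (hf : IsInstrument f) {a : A' ⟶ A} {b : B ⟶ B'} (ha : OperationCategory.normalized a)
    (hb : OperationCategory.normalized b) : IsInstrument fun o => a ≫ f o ≫ b := by
  have := OperationCategory.normalized_symmetricMonoidal (C := C)
  rw [IsInstrument, OperationCategory.comp_sum_comp]
  exact MorphismProperty.comp_mem _ _ _ ha (MorphismProperty.comp_mem _ _ _ hf hb)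

theorem correlations_subset {V : Type v} [Fintype V] {G : Digraph V} (O : V → Type t)
    [∀ x, Fintype (O x)] (p q : G.Polarization) : correlations C p O ⊆ correlations C q O := by
  rintro P ⟨X, f, hf, hP⟩
  let a (x : V) := (Shuffle.nonempty_of_perm (q.inList_perm p x)).some
  let b (x : V) := (Shuffle.nonempty_of_perm (p.outList_perm q x)).some
  refine ⟨X, fun x o => (a x).hom X ≫ f x o ≫ (b x).hom X,
    fun x => (hf x).comp_comp ((a x).normalized_hom X) ((b x).normalized_hom X), fun o => ?_⟩
  -- The singleton is replaced by the composites for `p`, leaving an equality of two sets of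
  -- composites.
  rw [Digraph.Polarization.IsValue, ← hP o]
  refine (Digraph.Polarization.composites_subset X _ _ a b fun _ => rfl).antisymm
    (Digraph.Polarization.composites_subset X _ _ (fun x => (a x).symm) (fun x => (b x).symm)
      fun x => ?_)
  -- Conjugating back by the inverse permutations recovers `f`.
  simp [Shuffle.hom_comp_symm_hom, reassoc_of% Shuffle.symm_hom_comp_hom X (a x)]

end CorrelationLemmas

theorem mainTheorem10 (C : Type u) [Category.{w} C] [MonoidalCategory C] [SymmetricCategory C]
    [OperationCategory C] {V : Type v} [Fintype V] (G : Digraph V) (hG : G.IsAcyclic)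
    (O : V → Type t) [∀ x, Fintype (O x)] (p q : G.Polarization) :
    correlations C p O = correlations C q O :=
  (correlations_subset O p q).antisymm (correlations_subset O q p)
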